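/- Let $p<0$ and $0<q<1$ with $1/p+1/q=1$, and let $X_1,\dots,X_n$ be independent nonnegative random variables such that $X_1\ge_{\mathrm{lr}}X_2\ge_{\mathrm{lr}}\cdots\ge_{\mathrm{lr}}X_n$ and such that, for each $i$, the random variable $X_i^p$ has a log-concave density with respect to Lebesgue measure. Then, for all $\mathbf a=(a_1,\dots,a_n)$ and $\mathbf b=(b_1,\dots,b_n)$ in $[0,\infty)^n$, $$(a_1^q,\dots,a_n^q)\succeq_{\mathrm w}(b_1^q,\dots,b_n^q)\quad\Longrightarrow\quad \sum_{i=1}^n a_{(n-i+1)}X_i\ \ge_{\mathrm{st}}\ \sum_{i=1}^n b_{(n-i+1)}X_i .$$ Here $x_{(1)}\le x_{(2)}\le\cdots\le x_{(n)}$ is the increasing arrangement of the components of $\mathbf x\in\mathbb R^n$. We write $\mathbf y\succeq_{\mathrm w}\mathbf x$ ($\mathbf x$ is weakly submajorized by $\mathbf y$) if $\sum_{i=j}^n x_{(i)}\le\sum_{i=j}^n y_{(i)}$ for $j=1,\dots,n$. We write $Y\ge_{\mathrm{st}}X$ if $\mathbb P(Y\le t)\le \mathbb P(X\le t)$ for all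 $t\in\mathbb R$. We write $Y\ge_{\mathrm{lr}}X$ if $X$ and $Y$ have densities $f$ and $g$, respectively, for suitable versions of which $g(x)/f(x)$ is nondecreasing in $x$ on the set of those $x$ at which $f(x)$ and $g(x)$ are not both $0$ (with $c/0=\infty$ for $c>0$). A function $h:\mathbb R\to[0,\infty)$ is log-concave if $h(\alpha x+(1-\alpha)y)\ge h(x)^\alpha h(y)^{1-\alpha}$ for all $x,y\in\mathbb R$ and $\alpha\in[0,1]$. -/

import Mathlib

open MeasureTheory ProbabilityTheory
open scoped NNReal ENNReal

namespace WeightedSums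

/-- `f` is a (version of the) density, with respect to Lebesgue measure, of the law of the real
random variable `X`. -/
def IsDensity {Ω : Type*} [MeasurableSpace Ω] (μ : Measure Ω) (X : Ω → ℝ) (f : ℝ → ℝ≥0) : Prop :=
  Measurable f ∧ μ.map X = volume.withDensity (fun x => (f x : ℝ≥0∞))

/-- The usual stochastic order `X ≤_st Y`: the distribution functions satisfy `F_X(t) ≥ F_Y(t)`
for all `t`. -/
def StLE {Ω : Type*} [MeasurableSpace Ω] (μ : Measure Ω) (X Y : Ω → ℝ) : Prop :=
  ∀ t : ℝ, μ {ω | Y ω ≤ t} ≤ μ {ω | X ω ≤ t}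

/-- The likelihood ratio order `X ≤_lr Y`: for suitable versions `f`, `g` of the densities of `X`
and `Y`, the ratio `g / f` is increasing on the set where it is well defined, that is, where it is
not `0 / 0`.  The ratio is taken in `[0, ∞]`, where `c / 0 = ∞` for `c > 0`. -/
def LrLE {Ω : Type*} [MeasurableSpace Ω] (μ : Measure Ω) (X Y : Ω → ℝ) : Prop :=
  ∃ f g : ℝ → ℝ≥0, IsDensity μ X f ∧ IsDensity μ Y g ∧
    MonotoneOn (fun x => (g x : ℝ≥0∞) / (f x : ℝ≥0∞)) {x | ¬ (f x = 0 ∧ g x = 0)}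

/-- A nonnegative function on the line is log-concave if
`h (α x + (1 - α) y) ≥ h(x) ^ α * h(y) ^ (1 - α)` for all `x`, `y` and `α ∈ [0, 1]`. -/
def LogConcave (h : ℝ → ℝ≥0) : Prop :=
  ∀ x y α : ℝ, 0 ≤ α → α ≤ 1 → h x ^ α * h y ^ (1 - α) ≤ h (α * x + (1 - α) * y)

/-- The random variable `X` has a log-concave density. -/
def HasLogConcaveDensity {Ω : Type*} [MeasurableSpace Ω] (μ : Measure Ω) (X : Ω → ℝ) : Prop :=
  ∃ f : ℝ → ℝ≥0, IsDensity μ X f ∧ LogConcave f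

/-- The increasing arrangement `x_(1) ≤ x_(2) ≤ ⋯ ≤ x_(n)` of the components of `x`
(indexed from `0`). -/
noncomputable def incArr {n : ℕ} (x : Fin n → ℝ) : Fin n → ℝ :=
  x ∘ Tuple.sort x

/-- Weak submajorization: `x` is weakly submajorized by `y` if
`∑_{i ≥ j} x_(i) ≤ ∑_{i ≥ j} y_(i)` for every `j`. -/
def WeakSubmajorizedBy {n : ℕ} (x y : Fin n → ℝ) : Prop :=
  ∀ j : Fin n, ∑ i ∈ Finset.Ici j, incArr x i ≤ ∑ i ∈ Finset.Ici j, incArr y i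

end WeightedSums

/-! Put `r = 1/q > 1`, so that `1/p = 1 - r`, fix `τ`, and let `G c` be the probability that `∑ c_k
X_k ≤ τ`. With `Y_k = X_k ^ p`, the event for `c = u ^ r` reads `∑ u_k ^ r * Y_k ^ (1 - r) ≤ τ`. Its
left side is jointly convex in `(u, Y)`, and the joint density of `Y` is log-concave. By
Prékopa–Leindler, `G (u ^ r)` is log-concave in `u ≥ 0`, so its superlevel sets are convex
(`convex_setOf_le_measure_sum_le`).

The likelihood ratio order enters separately: moving a larger coefficient to a smaller variable can
only raise `G` (`measure_sum_le_swap`). Hence the decreasing arrangement of `a` minimizes `G` among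
all rearrangements (`le_of_adjacent_swap`). The superlevel set at this minimum contains every
rearrangement of `a ^ q`, hence their convex hull. The decreasing arrangement of `b ^ q` lies below
a point of that hull (`WeakSubmajorizedBy.exists_mem_convexHull`), and lowering coefficients of
nonnegative variables raises `G`. -/

namespace WeightedSums

/-! ### Brunn–Minkowski and Prékopa–Leindler inequalities -/

/-- The Brunn–Minkowski inequality on the line, for compact sets. -/
lemma volume_add_volume_le_of_isCompact {K L C : Set ℝ} (hK : IsCompact K) (hL : IsCompact L)
    (hK' : K.Nonempty) (hL' : L.Nonempty) (h : ∀ x ∈ K, ∀ y ∈ L, x + y ∈ C) :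
    volume K + volume L ≤ volume C := by
  -- The translates `K + b` and `a + L` both lie in `C`; since `a = max K` and `b = min L`, they can
  -- meet only at `a + b`.
  obtain ⟨a, haK, ha⟩ := hK.exists_isGreatest hK'
  obtain ⟨b, hbL, hb⟩ := hL.exists_isLeast hL'
  have h1 : volume ((fun x => x + b) '' K) = volume K := by
    rw [Set.image_add_right, measure_preimage_add_right]
  have h2 : volume ((fun y => a + y) '' L) = volume L := by
    rw [Set.image_add_left, measure_preimage_add]
  have hm : MeasurableSet ((fun y => a + y) '' L) :=
    (hL.image (by fun_prop)).measurableSet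
  have h3 : volume (((fun x => x + b) '' K) ∩ ((fun y => a + y) '' L)) = 0 := by
    refine measure_mono_null (t := {a + b}) ?_ (by simp)
    rintro _ ⟨⟨x, hx, rfl⟩, ⟨y, hy, hxy⟩⟩
    have := ha hx
    have := hb hy
    simp only [Set.mem_singleton_iff] at *
    linarith
  rw [← h1, ← h2, ← measure_union_add_inter _ hm, h3, add_zero]
  refine measure_mono ?_
  rintro _ (⟨x, hx, rfl⟩ | ⟨y, hy, rfl⟩)
  · exact h x hx b hbL
  · exact h a haK y hy

/-- The Brunn–Minkowski inequality on the line, for measurable sets. -/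
lemma volume_add_volume_le {A B C : Set ℝ} (hA : MeasurableSet A) (hB : MeasurableSet B)
    (hA' : A.Nonempty) (hB' : B.Nonempty) (h : ∀ x ∈ A, ∀ y ∈ B, x + y ∈ C) :
    volume A + volume B ≤ volume C := by
  obtain ⟨a, ha⟩ := hA'
  obtain ⟨b, hb⟩ := hB'
  rw [hA.measure_eq_iSup_isCompact volume, hB.measure_eq_iSup_isCompact volume]
  simp only [iSup_and']
  refine ENNReal.biSup_add_biSup_le' ⟨∅, Set.empty_subset _, isCompact_empty⟩
    ⟨∅, Set.empty_subset _, isCompact_empty⟩ ?_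
  rintro K ⟨hKA, hK⟩ L ⟨hLB, hL⟩
  -- The approximating compact sets may be empty; adding a point to each repairs this.
  refine (add_le_add (measure_mono (Set.subset_insert a K))
    (measure_mono (Set.subset_insert b L))).trans ?_
  exact volume_add_volume_le_of_isCompact (hK.insert a) (hL.insert b) (Set.insert_nonempty _ _)
    (Set.insert_nonempty _ _) fun x hx y hy =>
      h x (Set.insert_subset ha hKA hx) y (Set.insert_subset hb hLB hy)

/-- The weighted Brunn–Minkowski inequality on the line. -/
lemma mul_volume_add_mul_volume_le {s t : ℝ} (hs : 0 < s) (ht : 0 < t) {A B C : Set ℝ}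
    (hA : MeasurableSet A) (hB : MeasurableSet B)
    (hA' : A.Nonempty) (hB' : B.Nonempty) (h : ∀ x ∈ A, ∀ y ∈ B, s * x + t * y ∈ C) :
    ENNReal.ofReal s * volume A + ENNReal.ofReal t * volume B ≤ volume C := by
  have h1 := Measure.addHaar_smul (volume : Measure ℝ) s A
  have h2 := Measure.addHaar_smul (volume : Measure ℝ) t B
  simp only [Module.finrank_self, pow_one, abs_of_pos hs, abs_of_pos ht] at h1 h2
  rw [← h1, ← h2]
  refine volume_add_volume_le (hA.const_smul₀ s) (hB.const_smul₀ t) hA'.smul_set hB'.smul_set ?_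
  rintro _ ⟨x, hx, rfl⟩ _ ⟨y, hy, rfl⟩
  exact h x hx y hy

/-- The weighted arithmetic-geometric mean inequality in `[0, ∞]`. -/
lemma rpow_mul_rpow_le {s t : ℝ} (hs : 0 < s) (ht : 0 < t) (hst : s + t = 1) (a b : ℝ≥0∞) :
    a ^ s * b ^ t ≤ ENNReal.ofReal s * a + ENNReal.ofReal t * b := by
  have hc : (s⁻¹).HolderConjugate t⁻¹ := by
    rw [Real.holderConjugate_iff]
    refine ⟨(one_lt_inv₀ hs).2 (by linarith), by simpa using hst⟩
  have := ENNReal.young_inequality (a ^ s) (b ^ t) hc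
  rwa [← ENNReal.rpow_mul, ← ENNReal.rpow_mul, mul_inv_cancel₀ hs.ne', mul_inv_cancel₀ ht.ne',
    ENNReal.rpow_one, ENNReal.rpow_one, ENNReal.ofReal_inv_of_pos hs, ENNReal.ofReal_inv_of_pos ht,
    div_eq_mul_inv, div_eq_mul_inv, inv_inv, inv_inv, mul_comm a, mul_comm b] at this

/-- The layer cake formula for functions with values in `[0, 1]`. -/
lemma lintegral_eq_lintegral_Ioo_meas_lt {F : ℝ → ℝ≥0∞} (hF : Measurable F) (hF1 : ∀ x, F x ≤ 1) :
    ∫⁻ x, F x = ∫⁻ r in Set.Ioo (0 : ℝ) 1, volume {x | ENNReal.ofReal r < F x} := by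
  have hfin : ∀ x, F x ≠ ∞ := fun x => ne_top_of_le_ne_top ENNReal.one_ne_top (hF1 x)
  have h := lintegral_eq_lintegral_meas_lt (f := fun x => (F x).toReal) volume
    (Filter.Eventually.of_forall fun _ => ENNReal.toReal_nonneg) hF.ennreal_toReal.aemeasurable
  simp only [ENNReal.ofReal_toReal (hfin _)] at h
  have h' : ∀ r : ℝ, 0 < r → {x | r < (F x).toReal} = {x | ENNReal.ofReal r < F x} := by
    intro r hr
    ext x
    simp only [Set.mem_ofPred_eq]
    rw [ENNReal.ofReal_lt_iff_lt_toReal hr.le (hfin x)]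
  rw [h, ← Set.Ioo_union_Ici_eq_Ioi zero_lt_one,
    lintegral_union measurableSet_Ici (Set.disjoint_left.2 fun x hx hx' => not_lt.2 hx' hx.2)]
  have : ∫⁻ r in Set.Ici (1 : ℝ), volume {x | r < (F x).toReal} = 0 := by
    rw [setLIntegral_congr_fun (g := fun _ => 0) measurableSet_Ici]
    · simp
    · intro r hr
      have : {x | r < (F x).toReal} = ∅ := by
        ext x
        have := ENNReal.toReal_mono ENNReal.one_ne_top (hF1 x)
        simp only [Set.mem_Ici, ENNReal.toReal_one] at hr this
        simp only [Set.mem_ofPred_eq, Set.mem_empty_iff_false, iff_false, not_lt]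
        linarith
      simp [this]
  rw [this, add_zero]
  exact setLIntegral_congr_fun measurableSet_Ioo fun r hr => by simp only [h' r hr.1]

/-- The Prékopa–Leindler inequality on the line for functions with supremum `1`. -/
lemma prekopaLeindler_of_iSup_eq_one {s t : ℝ} (hs : 0 < s) (ht : 0 < t) (hst : s + t = 1)
    {F G H : ℝ → ℝ≥0∞} (hF : Measurable F) (hG : Measurable G) (hH : Measurable H)
    (hF1 : ⨆ x, F x = 1) (hG1 : ⨆ x, G x = 1)
    (h : ∀ x y, F x ^ s * G y ^ t ≤ H (s * x + t * y)) :
    (∫⁻ x, F x) ^ s * (∫⁻ x, G x) ^ t ≤ ∫⁻ x, H x := by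
  -- The stronger bound by the weighted arithmetic mean holds here: with both suprema `1`, the level
  -- sets of `F` and `G` are nonempty for the same `r < 1`, and Brunn–Minkowski applies level by
  -- level.
  refine (rpow_mul_rpow_le hs ht hst _ _).trans ?_
  have hH' : Measurable fun x => min (H x) 1 := hH.min measurable_const
  refine le_trans ?_ (lintegral_mono fun x => min_le_left (H x) 1)
  have hFm : ∀ r : ℝ, MeasurableSet {x | ENNReal.ofReal r < F x} :=
    fun r => measurableSet_lt measurable_const hF
  rw [lintegral_eq_lintegral_Ioo_meas_lt hF fun x => hF1 ▸ le_iSup F x,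
    lintegral_eq_lintegral_Ioo_meas_lt hG fun x => hG1 ▸ le_iSup G x,
    lintegral_eq_lintegral_Ioo_meas_lt hH' fun x => min_le_right _ _]
  have hanti : ∀ f : ℝ → ℝ≥0∞, Measurable fun r : ℝ => volume {x | ENNReal.ofReal r < f x} := by
    intro f
    refine Antitone.measurable fun r r' hr => measure_mono fun x hx => ?_
    exact lt_of_le_of_lt (ENNReal.ofReal_le_ofReal hr) hx
  rw [← lintegral_const_mul _ (hanti F), ← lintegral_const_mul _ (hanti G),
    ← lintegral_add_left ((hanti F).const_mul _)]
  refine setLIntegral_mono' measurableSet_Ioo fun r hr => ?_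
  have hr1 : ENNReal.ofReal r < 1 := by simpa using hr.2
  refine mul_volume_add_mul_volume_le hs ht (hFm r) (measurableSet_lt measurable_const hG)
    (lt_iSup_iff.1 (hF1 ▸ hr1 : ENNReal.ofReal r < ⨆ x, F x))
    (lt_iSup_iff.1 (hG1 ▸ hr1 : ENNReal.ofReal r < ⨆ x, G x)) ?_
  intro x hx y hy
  refine lt_min (lt_of_lt_of_le ?_ (h x y)) hr1
  calc ENNReal.ofReal r = ENNReal.ofReal r ^ s * ENNReal.ofReal r ^ t := by
        rw [← ENNReal.rpow_add_of_nonneg _ _ hs.le ht.le, hst, ENNReal.rpow_one]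
    _ < F x ^ s * G y ^ t :=
        ENNReal.mul_lt_mul (ENNReal.rpow_lt_rpow hx hs) (ENNReal.rpow_lt_rpow hy ht)

/-- The Prékopa–Leindler inequality on the line for bounded functions. -/
lemma prekopaLeindler_of_iSup_ne_top {s t : ℝ} (hs : 0 < s) (ht : 0 < t) (hst : s + t = 1)
    {F G H : ℝ → ℝ≥0∞} (hF : Measurable F) (hG : Measurable G) (hH : Measurable H)
    (hFb : ⨆ x, F x ≠ ∞) (hGb : ⨆ x, G x ≠ ∞)
    (h : ∀ x y, F x ^ s * G y ^ t ≤ H (s * x + t * y)) :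
    (∫⁻ x, F x) ^ s * (∫⁻ x, G x) ^ t ≤ ∫⁻ x, H x := by
  set M := ⨆ x, F x with hM
  set N := ⨆ x, G x with hN
  rcases eq_or_ne M 0 with hM0 | hM0
  · have : ∀ x, F x = 0 := fun x => le_antisymm (hM0 ▸ le_iSup F x) zero_le
    simp [this, hs]
  rcases eq_or_ne N 0 with hN0 | hN0
  · have : ∀ x, G x = 0 := fun x => le_antisymm (hN0 ▸ le_iSup G x) zero_le
    simp [this, ht]
  have hMi : M⁻¹ ≠ ∞ := ENNReal.inv_ne_top.2 hM0
  have hNi : N⁻¹ ≠ ∞ := ENNReal.inv_ne_top.2 hN0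
  have key := prekopaLeindler_of_iSup_eq_one hs ht hst (F := fun x => M⁻¹ * F x)
    (G := fun x => N⁻¹ * G x) (H := fun x => ((M⁻¹) ^ s * (N⁻¹) ^ t) * H x)
    (hF.const_mul _) (hG.const_mul _) (hH.const_mul _)
    (by rw [← ENNReal.mul_iSup, ← hM, ENNReal.inv_mul_cancel hM0 hFb])
    (by rw [← ENNReal.mul_iSup, ← hN, ENNReal.inv_mul_cancel hN0 hGb])
    (fun x y => by
      rw [ENNReal.mul_rpow_of_nonneg _ _ hs.le, ENNReal.mul_rpow_of_nonneg _ _ ht.le,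
        mul_mul_mul_comm]
      exact mul_le_mul_right (h x y) _)
  rw [lintegral_const_mul _ hF, lintegral_const_mul _ hG, lintegral_const_mul _ hH,
    ENNReal.mul_rpow_of_nonneg _ _ hs.le, ENNReal.mul_rpow_of_nonneg _ _ ht.le,
    mul_mul_mul_comm] at key
  refine (ENNReal.mul_le_mul_iff_right ?_ ?_).1 key
  · exact mul_ne_zero (by simp [hs, hFb, ENNReal.rpow_eq_zero_iff, hs.not_gt])
      (by simp [ht, hGb, ENNReal.rpow_eq_zero_iff, ht.not_gt])
  · exact ENNReal.mul_ne_top (ENNReal.rpow_ne_top_of_nonneg hs.le hMi)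
      (ENNReal.rpow_ne_top_of_nonneg ht.le hNi)

lemma lintegral_eq_iSup_lintegral_min {α : Type*} [MeasurableSpace α] (μ : Measure α)
    {F : α → ℝ≥0∞} (hF : Measurable F) :
    ∫⁻ x, F x ∂μ = ⨆ k : ℕ, ∫⁻ x, min (F x) k ∂μ := by
  rw [← lintegral_iSup (fun k => hF.min measurable_const)]
  · refine lintegral_congr fun x => ?_
    rw [← inf_iSup_eq, ENNReal.iSup_natCast, inf_top_eq]
  · intro k l hkl x
    exact min_le_min_left _ (by exact_mod_cast hkl)

/-- The Prékopa–Leindler inequality on the line. -/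
theorem prekopaLeindler_real {s t : ℝ} (hs : 0 < s) (ht : 0 < t) (hst : s + t = 1)
    {F G H : ℝ → ℝ≥0∞} (hF : Measurable F) (hG : Measurable G) (hH : Measurable H)
    (h : ∀ x y, F x ^ s * G y ^ t ≤ H (s * x + t * y)) :
    (∫⁻ x, F x) ^ s * (∫⁻ x, G x) ^ t ≤ ∫⁻ x, H x := by
  have hiso : ∀ {r : ℝ} (_ : 0 < r) (f : ℕ → ℝ≥0∞), (⨆ k, f k) ^ r = ⨆ k, f k ^ r :=
    fun {r} hr f => (ENNReal.orderIsoRpow r hr).map_iSup f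
  rw [lintegral_eq_iSup_lintegral_min volume hF, lintegral_eq_iSup_lintegral_min volume hG,
    hiso hs, hiso ht]
  simp only [ENNReal.iSup_mul, ENNReal.mul_iSup, iSup_le_iff]
  intro k l
  refine prekopaLeindler_of_iSup_ne_top hs ht hst (hF.min measurable_const)
    (hG.min measurable_const) hH ?_ ?_ fun x y => le_trans ?_ (h x y)
  · exact ne_top_of_le_ne_top (ENNReal.natCast_ne_top _) (iSup_le fun x => min_le_right _ _)
  · exact ne_top_of_le_ne_top (ENNReal.natCast_ne_top _) (iSup_le fun x => min_le_right _ _)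
  · gcongr <;> exact min_le_left _ _

/-- Integration over `Fin (n + 1) → ℝ` with the zeroth coordinate split off. -/
lemma lintegral_fin_succ {n : ℕ} {F : (Fin (n + 1) → ℝ) → ℝ≥0∞} (hF : Measurable F) :
    ∫⁻ x, F x = ∫⁻ x₀ : ℝ, ∫⁻ x : Fin n → ℝ, F (Fin.cons x₀ x) := by
  have h := (volume_preserving_piFinSuccAbove (fun _ : Fin (n + 1) => ℝ) 0).symm
  rw [← h.lintegral_comp hF, Measure.volume_eq_prod, lintegral_prod]
  · simp [MeasurableEquiv.piFinSuccAbove, Fin.insertNthEquiv]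
  · exact (hF.comp h.measurable).aemeasurable

/-- The Prékopa–Leindler inequality. -/
theorem prekopaLeindler {s t : ℝ} (hs : 0 < s) (ht : 0 < t) (hst : s + t = 1) :
    ∀ {n : ℕ} {F G H : (Fin n → ℝ) → ℝ≥0∞}, Measurable F → Measurable G → Measurable H →
    (∀ x y, F x ^ s * G y ^ t ≤ H (s • x + t • y)) →
    (∫⁻ x, F x) ^ s * (∫⁻ x, G x) ^ t ≤ ∫⁻ x, H x
  | 0, F, G, H, hF, hG, hH, h => by
    have : (volume : Measure (Fin 0 → ℝ)) = Measure.dirac 0 := by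
      rw [volume_pi, Measure.pi_of_empty _ 0]
    rw [this, lintegral_dirac' _ hF, lintegral_dirac' _ hG, lintegral_dirac' _ hH]
    simpa using h 0 0
  | n + 1, F, G, H, hF, hG, hH, h => by
    have hcons : Measurable fun z : ℝ × (Fin n → ℝ) => (Fin.cons z.1 z.2 : Fin (n + 1) → ℝ) := by
      refine measurable_pi_iff.2 fun i => ?_
      refine Fin.cases ?_ (fun j => ?_) i
      · simpa using measurable_fst
      · simp only [Fin.cons_succ]; fun_prop
    rw [lintegral_fin_succ hF, lintegral_fin_succ hG, lintegral_fin_succ hH]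
    -- The slices at `x₀` and `y₀` satisfy the hypothesis in dimension `n`, so the slice integrals
    -- satisfy it on the line.
    refine prekopaLeindler_real hs ht hst (hF.comp hcons).lintegral_prod_right'
      (hG.comp hcons).lintegral_prod_right' (hH.comp hcons).lintegral_prod_right' fun x₀ y₀ => ?_
    refine prekopaLeindler hs ht hst (hF.comp (hcons.comp measurable_prodMk_left))
      (hG.comp (hcons.comp measurable_prodMk_left)) (hH.comp (hcons.comp measurable_prodMk_left))
      fun x y => ?_
    refine (h (Fin.cons x₀ x) (Fin.cons y₀ y)).trans (le_of_eq ?_)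
    congr 1
    ext i
    refine Fin.cases ?_ (fun j => ?_) i <;> simp

/-! ### Weak submajorization and rearrangements -/

/-- If `w` is increasing and nonnegative and `d` has nonnegative tail sums, then `∑ w d ≥ 0`. -/
lemma sum_mul_nonneg_of_tail_sums :
    ∀ {n : ℕ} {w d : Fin n → ℝ}, Monotone w → (∀ i, 0 ≤ w i) →
    (∀ j, 0 ≤ ∑ i ∈ Finset.Ici j, d i) → 0 ≤ ∑ i, w i * d i
  | 0, w, d, _, _, _ => by simp
  | n + 1, w, d, hw, hw0, hd => by
    have hd' : ∀ j, 0 ≤ ∑ i, if j ≤ i then d i else 0 := fun j => by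
      have := hd j
      rwa [← Finset.filter_le_eq_Ici, Finset.sum_filter] at this
    have h0 := hd' 0
    simp only [Fin.zero_le, if_true] at h0
    -- Summation by parts: the constant part `w 0` multiplies the full sum of `d`, and `w - w 0`
    -- vanishes at index `0`.
    have ih := sum_mul_nonneg_of_tail_sums (w := fun k : Fin n => w k.succ - w 0)
      (d := fun k => d k.succ) (fun k l hkl => by
        have := hw (Fin.succ_le_succ_iff.2 hkl)
        simp only; linarith)
      (fun k => sub_nonneg.2 (hw (Fin.zero_le _))) (fun j => by
        have := hd' j.succ
        rw [Fin.sum_univ_succ] at this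
        simpa [Fin.succ_le_succ_iff, ← Finset.filter_le_eq_Ici, Finset.sum_filter] using this)
    have : ∑ i, w i * d i = w 0 * ∑ i, d i + ∑ k : Fin n, (w k.succ - w 0) * d k.succ := by
      rw [Fin.sum_univ_succ, Fin.sum_univ_succ]
      simp only [sub_mul, Finset.sum_sub_distrib, ← Finset.mul_sum]
      ring
    rw [this]
    exact add_nonneg (mul_nonneg (hw0 0) h0) ih

lemma monotone_incArr {n : ℕ} (x : Fin n → ℝ) : Monotone (incArr x) :=
  Tuple.monotone_sort x

lemma incArr_eq_of_monotone {n : ℕ} {x : Fin n → ℝ} {σ : Equiv.Perm (Fin n)}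
    (h : Monotone (x ∘ σ)) : incArr x = x ∘ σ :=
  Tuple.unique_monotone (Tuple.monotone_sort x) h

/-- A weakly submajorized vector lies below the convex hull of the rearrangements of the
majorizing one. -/
theorem WeakSubmajorizedBy.exists_mem_convexHull {n : ℕ} {x y : Fin n → ℝ}
    (h : WeakSubmajorizedBy x y) :
    ∃ v ∈ convexHull ℝ (Set.range fun σ : Equiv.Perm (Fin n) => y ∘ σ), x ≤ v := by
  by_contra! hcon
  -- Otherwise a linear functional strictly separates the compact hull from the orthant above `x`.
  obtain ⟨f, u, v, hfu, huv, hfv⟩ := geometric_hahn_banach_compact_closed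
    (convex_convexHull ℝ _) ((Set.finite_range
      fun σ : Equiv.Perm (Fin n) => y ∘ σ).isCompact_convexHull ℝ) (convex_Ici x) isClosed_Ici
    (Set.disjoint_left.2 fun v hv hxv => hcon v hv hxv)
  set w : Fin n → ℝ := fun i => f (Pi.single i 1) with hw
  have hf : ∀ z : Fin n → ℝ, f z = ∑ i, w i * z i := by
    intro z
    conv_lhs => rw [← Finset.univ_sum_single z]
    rw [map_sum]
    refine Finset.sum_congr rfl fun i _ => ?_
    have : (Pi.single i (z i) : Fin n → ℝ) = z i • Pi.single i 1 := by
      rw [← Pi.single_smul]; simp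
    rw [this, map_smul, smul_eq_mul, mul_comm]
  -- `f` is bounded below on an upward orthant, so no weight is negative.
  have hw0 : ∀ i, 0 ≤ w i := by
    intro i
    by_contra! hi
    have h1 := hfv x Set.self_mem_Ici
    obtain ⟨N, hN⟩ := exists_nat_gt ((f x - v) / -w i)
    have h2 := hfv (x + (N : ℝ) • Pi.single i 1) (by
      intro k
      have : (0 : ℝ) ≤ N * (Pi.single i (1 : ℝ) : Fin n → ℝ) k :=
        mul_nonneg N.cast_nonneg (by
          rcases eq_or_ne k i with rfl | hk
          · simp
          · simp [hk])
      simpa using this)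
    rw [map_add, map_smul, smul_eq_mul] at h2
    rw [div_lt_iff₀ (by linarith)] at hN
    change v < f x + N * w i at h2
    linarith
  set σ := Tuple.sort w
  have hσ : Monotone (w ∘ σ) := Tuple.monotone_sort w
  have hx : f x ≤ ∑ i, (w ∘ σ) i * incArr x i := by
    rw [hf]
    have := (hσ.monovary (monotone_incArr x)).sum_mul_comp_perm_le_sum_mul
      (σ := σ.trans (Tuple.sort x).symm)
    refine le_trans (le_of_eq ?_) this
    rw [← Equiv.sum_comp σ]
    simp [incArr]
  have hxy := sum_mul_nonneg_of_tail_sums (d := fun i => incArr y i - incArr x i) hσ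
    (fun i => hw0 _) fun j => by
      rw [Finset.sum_sub_distrib]
      exact sub_nonneg.2 (h j)
  -- This rearrangement of `y` is ordered like `w`, so `f` there is at least `f x`, against the
  -- separation.
  have hy := hfu (y ∘ (σ.symm.trans (Tuple.sort y)))
    (subset_convexHull ℝ _ ⟨σ.symm.trans (Tuple.sort y), rfl⟩)
  have hy' : f (y ∘ (σ.symm.trans (Tuple.sort y))) = ∑ i, (w ∘ σ) i * incArr y i := by
    rw [hf, ← Equiv.sum_comp σ]
    simp [incArr]
  have := hfv x Set.self_mem_Ici
  simp only [mul_sub, Finset.sum_sub_distrib] at hxy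
  linarith

/-- A function on vectors that does not decrease when two adjacent components are put in increasing
order is minimized, among all rearrangements of a vector, at the decreasing one. -/
theorem le_of_adjacent_swap {n : ℕ} {α : Type*} [Preorder α] (G : (Fin n → ℝ) → α)
    (hG : ∀ (c : Fin n → ℝ) (i j : Fin n), (j : ℕ) = i + 1 → c j ≤ c i →
      G c ≤ G (c ∘ Equiv.swap i j)) (c : Fin n → ℝ) :
    G (incArr c ∘ Fin.rev) ≤ G c := by
  classical
  -- Among rearrangements not exceeding `G c`, take one minimizing `∑ k * c (π k)`: swapping an
  -- adjacent ascent would lower this sum without raising `G`, so there is none.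
  obtain ⟨π, hπ, hmin⟩ := Finset.exists_min_image
    (Finset.univ.filter fun π : Equiv.Perm (Fin n) => G (c ∘ π) ≤ G c)
    (fun π => ∑ k : Fin n, (k : ℝ) * c (π k)) ⟨1, by simp⟩
  simp only [Finset.mem_filter, Finset.mem_univ, true_and] at hπ hmin
  have hadj : ∀ i j : Fin n, (j : ℕ) = i + 1 → c (π j) ≤ c (π i) := by
    intro i j hij
    by_contra! hlt
    have hne : i ≠ j := fun h => by simp [h] at hij
    have h1 := hG (c ∘ ((Equiv.swap i j).trans π)) i j hij (by simpa using hlt.le)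
    have h2 : (c ∘ ((Equiv.swap i j).trans π)) ∘ Equiv.swap i j = c ∘ π := by
      ext k; simp
    rw [h2] at h1
    have h3 := hmin _ (h1.trans hπ)
    have h4 : ∑ k : Fin n, (k : ℝ) * c (((Equiv.swap i j).trans π) k)
        = ∑ k : Fin n, ((Equiv.swap i j k : Fin n) : ℝ) * c (π k) := by
      rw [← Equiv.sum_comp (Equiv.swap i j)]
      simp
    rw [h4, ← sub_nonneg, ← Finset.sum_sub_distrib, Fintype.sum_eq_add i j hne] at h3
    · simp only [Equiv.swap_apply_left, Equiv.swap_apply_right, hij] at h3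
      push_cast at h3
      linarith
    · rintro k ⟨hki, hkj⟩
      simp [Equiv.swap_apply_of_ne_of_ne hki hkj]
  have hanti : Antitone (c ∘ π) := by
    cases n with
    | zero => exact fun i => i.elim0
    | succ n => exact Fin.antitone_iff_succ_le.2 fun i => hadj _ _ (by simp)
  have hmono : Monotone (c ∘ (Fin.revPerm.trans π)) := fun i j hij =>
    hanti (Fin.rev_le_rev.2 hij)
  have : incArr c ∘ Fin.rev = c ∘ π := by
    rw [incArr_eq_of_monotone hmono]
    ext k; simp
  rw [this]
  exact hπ

/-! ### Joint densities and the likelihood ratio order -/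

lemma lintegral_prod_fin_eq_prod_lintegral : ∀ {n : ℕ} {f : Fin n → ℝ → ℝ≥0∞},
    (∀ i, Measurable (f i)) → ∫⁻ x : Fin n → ℝ, ∏ i, f i (x i) = ∏ i, ∫⁻ x, f i x
  | 0, f, hf => by simp [volume_pi]
  | n + 1, f, hf => by
    rw [lintegral_fin_succ (by fun_prop)]
    simp only [Fin.prod_univ_succ, Fin.cons_zero, Fin.cons_succ]
    rw [← lintegral_prod_fin_eq_prod_lintegral fun i => hf i.succ,
      ← lintegral_mul_const _ (hf 0)]
    exact lintegral_congr fun x₀ => lintegral_const_mul _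
      (Finset.measurable_prod _ fun i _ => (hf i.succ).comp (measurable_pi_apply i))

/-- The joint law of independent real random variables with densities has the product density. -/
lemma map_eq_withDensity_prod {Ω : Type*} [MeasurableSpace Ω] {μ : Measure Ω}
    [IsProbabilityMeasure μ] {n : ℕ} {X : Fin n → Ω → ℝ} (hX : ∀ i, Measurable (X i))
    (hind : iIndepFun X μ) {f : Fin n → ℝ → ℝ≥0} (hf : ∀ i, IsDensity μ (X i) (f i)) :
    μ.map (fun ω i => X i ω)
      = volume.withDensity fun x : Fin n → ℝ => ∏ i, (f i (x i) : ℝ≥0∞) := by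
  have hfm : ∀ i, Measurable fun x => (f i x : ℝ≥0∞) := fun i => (hf i).1.coe_nnreal_ennreal
  rw [(iIndepFun_iff_map_fun_eq_pi_map fun i => (hX i).aemeasurable).1 hind]
  have : ∀ i, IsProbabilityMeasure (μ.map (X i)) := fun i =>
    Measure.isProbabilityMeasure_map (hX i).aemeasurable
  refine Measure.pi_eq fun s hs => ?_
  rw [withDensity_apply _ (MeasurableSet.univ_pi hs)]
  simp only [(hf _).2, withDensity_apply _ (hs _)]
  simp only [← lintegral_indicator (hs _)]
  rw [← lintegral_prod_fin_eq_prod_lintegral fun i => (hfm i).indicator (hs i),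
    ← lintegral_indicator (MeasurableSet.univ_pi hs)]
  refine lintegral_congr fun x => ?_
  by_cases hx : x ∈ Set.univ.pi s
  · rw [Set.indicator_of_mem hx]
    exact Finset.prod_congr rfl fun i _ => by
      rw [Set.indicator_of_mem (hx i (Set.mem_univ i))]
  · rw [Set.indicator_of_notMem hx]
    obtain ⟨i, hi⟩ : ∃ i, x i ∉ s i := by simpa [Set.mem_pi] using hx
    exact (Finset.prod_eq_zero (Finset.mem_univ i) (Set.indicator_of_notMem hi _)).symm

lemma measure_preimage_eq_lintegral {Ω : Type*} [MeasurableSpace Ω] {μ : Measure Ω}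
    [IsProbabilityMeasure μ] {n : ℕ} {X : Fin n → Ω → ℝ} (hX : ∀ i, Measurable (X i))
    (hind : iIndepFun X μ) {f : Fin n → ℝ → ℝ≥0} (hf : ∀ i, IsDensity μ (X i) (f i))
    {A : Set (Fin n → ℝ)} (hA : MeasurableSet A) :
    μ {ω | (fun i => X i ω) ∈ A}
      = ∫⁻ x, A.indicator (fun x => ∏ i, (f i (x i) : ℝ≥0∞)) x := by
  rw [lintegral_indicator hA, ← withDensity_apply _ hA, ← map_eq_withDensity_prod hX hind hf,
    Measure.map_apply (measurable_pi_iff.2 hX) hA]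
  rfl

/-- Cross-multiplied form of the likelihood ratio order, free of the conventions on zero
denominators. -/
lemma mul_le_mul_of_monotoneOn_div {f g : ℝ → ℝ≥0}
    (h : MonotoneOn (fun x => (g x : ℝ≥0∞) / (f x : ℝ≥0∞)) {x | ¬ (f x = 0 ∧ g x = 0)})
    {x y : ℝ} (hxy : x ≤ y) : g x * f y ≤ g y * f x := by
  rcases eq_or_ne (g x) 0 with hg | hg
  · simp [hg]
  rcases eq_or_ne (f y) 0 with hf | hf
  · simp [hf]
  have h1 : (g x : ℝ≥0∞) / f x ≤ g y / f y :=
    h (show ¬ _ from fun h => hg h.2) (show ¬ _ from fun h => hf h.1) hxy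
  have hfy : (f y : ℝ≥0∞) ≠ 0 := by exact_mod_cast hf
  have hgx : (g x : ℝ≥0∞) ≠ 0 := by exact_mod_cast hg
  have hfx : (f x : ℝ≥0∞) ≠ 0 := fun h0 => by
    rw [h0, ENNReal.div_zero hgx, top_le_iff] at h1
    exact ENNReal.div_ne_top ENNReal.coe_ne_top hfy h1
  have hfx' : f x ≠ 0 := by exact_mod_cast hfx
  rw [← ENNReal.coe_div hfx', ← ENNReal.coe_div hf, ENNReal.coe_le_coe,
    div_le_div_iff₀ hfx'.bot_lt hf.bot_lt] at h1
  exact h1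

/-- Pointwise core of the swap argument, with `x'` the reflection of `x`. When exactly one of `A`,
`A'` contains `x`, the other contains `x'`, and `hD` says that `A'` gets the point of larger
density. -/
lemma indicator_add_indicator_le {α : Type*} {A A' : Set α} {D : α → ℝ≥0∞} {x x' : α}
    (h : x' ∈ A ↔ x ∈ A') (h' : x' ∈ A' ↔ x ∈ A)
    (hD : ((x ∈ A' → x ∈ A) ∧ D x ≤ D x') ∨ ((x ∈ A → x ∈ A') ∧ D x' ≤ D x)) :
    A.indicator D x + A.indicator D x' ≤ A'.indicator D x + A'.indicator D x' := by
  by_cases h1 : x ∈ A <;> by_cases h2 : x ∈ A'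
  · rw [Set.indicator_of_mem h1, Set.indicator_of_mem h2, Set.indicator_of_mem (h.2 h2),
      Set.indicator_of_mem (h'.2 h1)]
  · rw [Set.indicator_of_mem h1, Set.indicator_of_notMem h2,
      Set.indicator_of_notMem (mt h.1 h2), Set.indicator_of_mem (h'.2 h1), add_zero, zero_add]
    exact hD.elim (fun h => h.2) fun h => absurd (h.1 h1) h2
  · rw [Set.indicator_of_notMem h1, Set.indicator_of_mem h2,
      Set.indicator_of_notMem (mt h'.1 h1), Set.indicator_of_mem (h.2 h2), add_zero, zero_add]
    exact hD.elim (fun h => absurd (h.1 h2) h1) fun h => h.2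
  · rw [Set.indicator_of_notMem h1, Set.indicator_of_notMem h2,
      Set.indicator_of_notMem (mt h'.1 h1), Set.indicator_of_notMem (mt h.1 h2)]

lemma prod_comp_swap_le {n : ℕ} {h : Fin n → ℝ → ℝ≥0} {i j : Fin n} (hij : i ≠ j)
    {x y : Fin n → ℝ} (hxy : ∀ k, k ≠ i → k ≠ j → x k = y k)
    (hle : h i (x i) * h j (x j) ≤ h i (y i) * h j (y j)) :
    ∏ k, (h k (x k) : ℝ≥0∞) ≤ ∏ k, (h k (y k) : ℝ≥0∞) := by
  have hj : j ∈ Finset.univ.erase i := by simp [hij.symm]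
  have hs : ∀ z : Fin n → ℝ, ∏ k, (h k (z k) : ℝ≥0∞)
      = ((h i (z i) * h j (z j) : ℝ≥0) : ℝ≥0∞)
        * ∏ k ∈ (Finset.univ.erase i).erase j, (h k (z k) : ℝ≥0∞) := fun z => by
    rw [← Finset.mul_prod_erase _ _ (Finset.mem_univ i), ← Finset.mul_prod_erase _ _ hj,
      ENNReal.coe_mul, mul_assoc]
  rw [hs x, hs y, Finset.prod_congr rfl (g := fun k => (h k (y k) : ℝ≥0∞)) fun k hk => by
    simp only [Finset.mem_erase] at hk
    rw [hxy k hk.2.1 hk.1]]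
  exact mul_le_mul_left (by exact_mod_cast hle) _

/-- Giving the larger of two coefficients to the larger, in the likelihood ratio order, of two
random variables makes the weighted sum stochastically larger. -/
theorem measure_sum_le_swap {Ω : Type*} [MeasurableSpace Ω] {μ : Measure Ω}
    [IsProbabilityMeasure μ] {n : ℕ} {X : Fin n → Ω → ℝ} (hX : ∀ i, Measurable (X i))
    (hind : iIndepFun X μ) (hdens : ∀ k, ∃ f, IsDensity μ (X k) f) {i j : Fin n} (hij : i ≠ j)
    (hlr : LrLE μ (X j) (X i)) {c : Fin n → ℝ} (hc : c j ≤ c i) (t : ℝ) :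
    μ {ω | ∑ k, c k * X k ω ≤ t} ≤ μ {ω | ∑ k, (c ∘ Equiv.swap i j) k * X k ω ≤ t} := by
  choose f₀ hf₀ using hdens
  obtain ⟨f, g, hf, hg, hfg⟩ := hlr
  -- At `i` and `j` the density versions must be those with monotone ratio.
  set h : Fin n → ℝ → ℝ≥0 := Function.update (Function.update f₀ j f) i g with hh
  have hi : h i = g := by simp [hh]
  have hj : h j = f := by simp [hh, hij.symm]
  have hd : ∀ k, IsDensity μ (X k) (h k) := by
    intro k
    by_cases hki : k = i
    · subst hki; rwa [hi]
    by_cases hkj : k = j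
    · subst hkj; rwa [hj]
    · simpa [hh, hki, hkj] using hf₀ k
  set σ := Equiv.swap i j with hσ
  have hσσ : ∀ k, σ (σ k) = k := fun k => by simp [hσ]
  set D : (Fin n → ℝ) → ℝ≥0∞ := fun x => ∏ k, (h k (x k) : ℝ≥0∞) with hD
  have hDm : Measurable D := Finset.measurable_prod _ fun k _ =>
    ((hd k).1.comp (measurable_pi_apply k)).coe_nnreal_ennreal
  set A : Set (Fin n → ℝ) := {x | ∑ k, c k * x k ≤ t} with hA
  set A' : Set (Fin n → ℝ) := {x | ∑ k, (c ∘ σ) k * x k ≤ t} with hA'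
  have hAm : MeasurableSet A := measurableSet_le (by fun_prop) measurable_const
  have hAm' : MeasurableSet A' := measurableSet_le (by fun_prop) measurable_const
  have hsum : ∀ x : Fin n → ℝ, ∑ k, (c ∘ σ) k * x k = ∑ k, c k * x (σ k) := fun x => by
    rw [← Equiv.sum_comp σ]
    simp [hσσ]
  have hmem : ∀ x : Fin n → ℝ, x ∘ σ ∈ A ↔ x ∈ A' := fun x => by
    change _ ≤ t ↔ _ ≤ t
    rw [hsum]; rfl
  have hmem' : ∀ x : Fin n → ℝ, x ∘ σ ∈ A' ↔ x ∈ A := fun x => by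
    change _ ≤ t ↔ _ ≤ t
    rw [hsum]; simp [hσσ]
  have hpres : MeasurePreserving (fun x : Fin n → ℝ => x ∘ σ) volume volume := by
    have := volume_measurePreserving_piCongrLeft (fun _ : Fin n => ℝ) σ
    convert this using 1
    ext x k
    rw [MeasurableEquiv.coe_piCongrLeft]
    conv_rhs => rw [← hσσ k, Equiv.piCongrLeft_apply_apply]
    rfl
  have e1 : μ {ω | ∑ k, c k * X k ω ≤ t} = ∫⁻ x, A.indicator D x :=
    measure_preimage_eq_lintegral hX hind hd hAm
  have e2 : μ {ω | ∑ k, (c ∘ σ) k * X k ω ≤ t} = ∫⁻ x, A'.indicator D x :=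
    measure_preimage_eq_lintegral hX hind hd hAm'
  have e3 := hpres.lintegral_comp (hDm.indicator hAm)
  have e4 := hpres.lintegral_comp (hDm.indicator hAm')
  have hdiff : ∀ x : Fin n → ℝ, ∑ k, c k * x (σ k) - ∑ k, c k * x k
      = (c i - c j) * (x j - x i) := fun x => by
    rw [← Finset.sum_sub_distrib, Fintype.sum_eq_add i j hij]
    · simp [hσ]; ring
    · rintro k ⟨hki, hkj⟩
      simp [hσ, Equiv.swap_apply_of_ne_of_ne hki hkj]
  have hother : ∀ (x : Fin n → ℝ) k, k ≠ i → k ≠ j → x k = (x ∘ σ) k := fun x k hki hkj => by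
    simp [hσ, Equiv.swap_apply_of_ne_of_ne hki hkj]
  -- Pairing `x` with its reflection doubles both integrals, as the reflection preserves volume, and
  -- makes the comparison pointwise.
  have key : ∫⁻ x, (A.indicator D x + A.indicator D (x ∘ σ))
      ≤ ∫⁻ x, (A'.indicator D x + A'.indicator D (x ∘ σ)) := by
    refine lintegral_mono fun x => indicator_add_indicator_le (hmem x) (hmem' x) ?_
    rcases le_total (x i) (x j) with hx | hx
    · have hsub : x ∈ A' → x ∈ A := fun hx' => by
        change _ ≤ t at hx'
        change _ ≤ t
        rw [hsum] at hx'
        nlinarith [hdiff x, mul_nonneg (sub_nonneg.2 hc) (sub_nonneg.2 hx)]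
      have hDle : D x ≤ D (x ∘ σ) := prod_comp_swap_le hij (hother x) (by
        simpa [hi, hj, hσ] using mul_le_mul_of_monotoneOn_div hfg hx)
      exact Or.inl ⟨hsub, hDle⟩
    · have hsub : x ∈ A → x ∈ A' := fun hx' => by
        change _ ≤ t at hx'
        change _ ≤ t
        rw [hsum]
        nlinarith [hdiff x, mul_nonneg (sub_nonneg.2 hc) (sub_nonneg.2 hx)]
      have hDle : D (x ∘ σ) ≤ D x := prod_comp_swap_le hij
        (fun k hki hkj => (hother x k hki hkj).symm) (by
        simpa [hi, hj, hσ] using mul_le_mul_of_monotoneOn_div hfg hx)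
      exact Or.inr ⟨hsub, hDle⟩
  rw [lintegral_add_left (hDm.indicator hAm), lintegral_add_left (hDm.indicator hAm'), e3, e4,
    ← e1, ← e2] at key
  by_contra! hlt
  exact absurd key (not_le.2 (ENNReal.add_lt_add hlt hlt))

/-! ### Log-concavity in the transformed coefficients -/

/-- The function `(u, x) ↦ u ^ r * x ^ (1 - r)` is jointly convex for `r ≥ 1`. -/
lemma rpow_mul_rpow_one_sub_convex {r s t u v x y : ℝ} (hr : 1 ≤ r) (hs : 0 < s) (ht : 0 < t)
    (hu : 0 ≤ u) (hv : 0 ≤ v) (hx : 0 < x) (hy : 0 < y) :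
    (s * u + t * v) ^ r * (s * x + t * y) ^ (1 - r)
      ≤ s * (u ^ r * x ^ (1 - r)) + t * (v ^ r * y ^ (1 - r)) := by
  -- The function is the perspective of the convex power `w ^ r`.
  have hpersp : ∀ {w z : ℝ}, 0 ≤ w → 0 < z → w ^ r * z ^ (1 - r) = z * (w / z) ^ r := by
    intro w z hw hz
    rw [Real.div_rpow hw hz.le, Real.rpow_sub hz, Real.rpow_one]
    ring
  have hz : 0 < s * x + t * y := by positivity
  rw [hpersp (by positivity) hz, hpersp hu hx, hpersp hv hy]
  have h := (convexOn_rpow hr).2 (show u / x ∈ Set.Ici 0 from div_nonneg hu hx.le)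
    (show v / y ∈ Set.Ici 0 from div_nonneg hv hy.le)
    (show 0 ≤ s * x / (s * x + t * y) by positivity)
    (show 0 ≤ t * y / (s * x + t * y) by positivity) (by field_simp)
  simp only [smul_eq_mul] at h
  have e : s * x / (s * x + t * y) * (u / x) + t * y / (s * x + t * y) * (v / y)
      = (s * u + t * v) / (s * x + t * y) := by
    field_simp
  rw [e] at h
  refine (mul_le_mul_of_nonneg_left h hz.le).trans (le_of_eq ?_)
  field_simp

lemma LogConcave.prod_rpow_le {n : ℕ} {h : Fin n → ℝ → ℝ≥0} (hh : ∀ k, LogConcave (h k))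
    {s t : ℝ} (hs : 0 < s) (ht : 0 < t) (hst : s + t = 1) (x y : Fin n → ℝ) :
    (∏ k, (h k (x k) : ℝ≥0∞)) ^ s * (∏ k, (h k (y k) : ℝ≥0∞)) ^ t
      ≤ ∏ k, (h k ((s • x + t • y) k) : ℝ≥0∞) := by
  obtain rfl : t = 1 - s := by linarith
  rw [← ENNReal.prod_rpow_of_nonneg hs.le, ← ENNReal.prod_rpow_of_nonneg ht.le,
    ← Finset.prod_mul_distrib]
  refine Finset.prod_le_prod' fun k _ => ?_
  rw [← ENNReal.coe_rpow_of_nonneg _ hs.le, ← ENNReal.coe_rpow_of_nonneg _ ht.le]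
  exact_mod_cast hh k (x k) (y k) s hs.le (by linarith)

/-- The positive vectors `y` with `∑ u ^ r * y ^ (1 - r) ≤ τ`. -/
def posSublevel {n : ℕ} (r τ : ℝ) (u : Fin n → ℝ) : Set (Fin n → ℝ) :=
  {y | (∀ k, 0 < y k) ∧ ∑ k, u k ^ r * y k ^ (1 - r) ≤ τ}

lemma measurableSet_posSublevel {n : ℕ} (r τ : ℝ) (u : Fin n → ℝ) :
    MeasurableSet (posSublevel r τ u) := by
  have h : posSublevel r τ u
      = (⋂ k, {y | 0 < y k}) ∩ {y | ∑ k, u k ^ r * y k ^ (1 - r) ≤ τ} := by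
    ext y; simp [posSublevel]
  rw [h]
  refine (MeasurableSet.iInter fun k => measurableSet_lt measurable_const
    (measurable_pi_apply k)).inter (measurableSet_le ?_ measurable_const)
  exact Finset.measurable_sum _ fun k _ =>
    ((show Measurable fun y : Fin n → ℝ => y k from measurable_pi_apply k).pow_const
      (1 - r)).const_mul (u k ^ r)

/-- If `h` is a product of log-concave functions, then the integral of `h` over the set of positive
vectors `y` with `∑ u ^ r * y ^ (1 - r) ≤ τ` is log-concave in `u`. -/
theorem lintegral_indicator_logConcave {n : ℕ} {h : Fin n → ℝ → ℝ≥0}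
    (hm : ∀ k, Measurable (h k)) (hh : ∀ k, LogConcave (h k))
    {r s t : ℝ} (hr : 1 ≤ r) (hs : 0 < s) (ht : 0 < t) (hst : s + t = 1) (τ : ℝ)
    {u v : Fin n → ℝ} (hu : 0 ≤ u) (hv : 0 ≤ v) :
    (∫⁻ x, (posSublevel r τ u).indicator
        (fun y => ∏ k, (h k (y k) : ℝ≥0∞)) x) ^ s
      * (∫⁻ x, (posSublevel r τ v).indicator
        (fun y => ∏ k, (h k (y k) : ℝ≥0∞)) x) ^ t
      ≤ ∫⁻ x, (posSublevel r τ (s • u + t • v)).indicator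
        (fun y => ∏ k, (h k (y k) : ℝ≥0∞)) x := by
  have hDm : Measurable fun y : Fin n → ℝ => ∏ k, (h k (y k) : ℝ≥0∞) :=
    Finset.measurable_prod _ fun k _ =>
      ((hm k).comp (measurable_pi_apply k)).coe_nnreal_ennreal
  refine prekopaLeindler hs ht hst (hDm.indicator (measurableSet_posSublevel r τ u))
    (hDm.indicator (measurableSet_posSublevel r τ v))
    (hDm.indicator (measurableSet_posSublevel r τ _)) fun x y => ?_
  by_cases hx : x ∈ posSublevel r τ u
  swap
  · rw [Set.indicator_of_notMem hx, ENNReal.zero_rpow_of_pos hs, zero_mul]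
    exact zero_le
  by_cases hy : y ∈ posSublevel r τ v
  swap
  · rw [Set.indicator_of_notMem hy, ENNReal.zero_rpow_of_pos ht, mul_zero]
    exact zero_le
  -- Positivity is essential: for `r > 1`, `0 ^ (1 - r) = 0` by convention, which would break
  -- convexity.
  have hz : s • x + t • y ∈ posSublevel r τ (s • u + t • v) := by
    refine ⟨fun k => add_pos (mul_pos hs (hx.1 k)) (mul_pos ht (hy.1 k)), ?_⟩
    calc ∑ k, (s • u + t • v) k ^ r * (s • x + t • y) k ^ (1 - r)
        ≤ ∑ k, (s * (u k ^ r * x k ^ (1 - r)) + t * (v k ^ r * y k ^ (1 - r))) :=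
          Finset.sum_le_sum fun k _ =>
            rpow_mul_rpow_one_sub_convex hr hs ht (hu k) (hv k) (hx.1 k) (hy.1 k)
      _ = s * ∑ k, u k ^ r * x k ^ (1 - r) + t * ∑ k, v k ^ r * y k ^ (1 - r) := by
          rw [Finset.sum_add_distrib, Finset.mul_sum, Finset.mul_sum]
      _ ≤ s * τ + t * τ := by
          gcongr
          exacts [hx.2, hy.2]
      _ = τ := by rw [← add_mul, hst, one_mul]
  rw [Set.indicator_of_mem hx, Set.indicator_of_mem hy,
    Set.indicator_of_mem hz]
  exact LogConcave.prod_rpow_le hh hs ht hst x y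

lemma IsDensity.ae_ne {Ω : Type*} [MeasurableSpace Ω] {μ : Measure Ω} {Y : Ω → ℝ} {f : ℝ → ℝ≥0}
    (h : IsDensity μ Y f) (hY : Measurable Y) (a : ℝ) : ∀ᵐ ω ∂μ, Y ω ≠ a := by
  have : μ.map Y {a} = 0 := by
    rw [h.2]
    exact withDensity_absolutelyContinuous _ _ (by simp)
  rw [Measure.map_apply hY (measurableSet_singleton a)] at this
  exact measure_eq_zero_iff_ae_notMem.1 this

/-- For independent nonnegative `X k` such that every `X k ^ p` has a log-concave density, the
vectors `u ≥ 0` for which `∑ u ^ r * X` lies below `τ` with at least a given probability form a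
convex set. -/
theorem convex_setOf_le_measure_sum_le {Ω : Type*} [MeasurableSpace Ω] {μ : Measure Ω}
    [IsProbabilityMeasure μ] {p r : ℝ} (hp : p < 0) (hpr : p⁻¹ = 1 - r)
    {n : ℕ} {X : Fin n → Ω → ℝ} (hX : ∀ i, Measurable (X i))
    (hX0 : ∀ i, ∀ᵐ ω ∂μ, 0 ≤ X i ω) (hind : iIndepFun X μ)
    (hlc : ∀ i, HasLogConcaveDensity μ (fun ω => X i ω ^ p)) (τ : ℝ) (m : ℝ≥0∞) :
    Convex ℝ {u : Fin n → ℝ | 0 ≤ u ∧ m ≤ μ {ω | ∑ k, u k ^ r * X k ω ≤ τ}} := by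
  have hr : 1 ≤ r := by
    have := inv_lt_zero.2 hp
    linarith
  choose h hd hh using hlc
  have hY : ∀ i, Measurable fun ω => X i ω ^ p := fun i => (hX i).pow_const p
  have hYind : iIndepFun (fun i ω => X i ω ^ p) μ :=
    hind.comp (fun _ x => x ^ p) fun _ => measurable_id.pow_const p
  have heq : ∀ u : Fin n → ℝ, μ {ω | ∑ k, u k ^ r * X k ω ≤ τ}
      = ∫⁻ x, (posSublevel r τ u).indicator
        (fun y => ∏ k, (h k (y k) : ℝ≥0∞)) x := by
    intro u
    rw [← measure_preimage_eq_lintegral hY hYind hd (measurableSet_posSublevel r τ u)]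
    refine measure_congr ?_
    -- A law with a density has no atom at `0`. As `0 ^ p = 0` by convention, this also excludes `X
    -- k = 0`.
    filter_upwards [ae_all_iff.2 hX0, ae_all_iff.2 fun i => (hd i).ae_ne (hY i) 0] with ω h0 h1
    refine propext ?_
    change _ ≤ τ ↔ (∀ k, 0 < X k ω ^ p) ∧ _ ≤ τ
    have hpos : ∀ k, 0 < X k ω ^ p := fun k =>
      lt_of_le_of_ne (Real.rpow_nonneg (h0 k) p) (h1 k).symm
    simp only [hpos, implies_true, true_and, ← hpr, Real.rpow_rpow_inv (h0 _) hp.ne]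
  rw [convex_iff_forall_pos]
  rintro u ⟨hu, hmu⟩ v ⟨hv, hmv⟩ s t hs ht hst
  refine ⟨add_nonneg (smul_nonneg hs.le hu) (smul_nonneg ht.le hv), ?_⟩
  rw [heq] at hmu hmv ⊢
  refine le_trans ?_ (lintegral_indicator_logConcave (fun k => (hd k).1) hh hr hs ht hst τ hu hv)
  calc m = m ^ s * m ^ t := by
        rw [← ENNReal.rpow_add_of_nonneg _ _ hs.le ht.le, hst, ENNReal.rpow_one]
    _ ≤ _ := by gcongr

/-! ### Proof of the main theorem -/

/-- For `2 ≤ n` every index belongs to an adjacent pair; for smaller `n` there is nothing to swap.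
-/
lemma exists_isDensity_of_lrLE {Ω : Type*} [MeasurableSpace Ω] {μ : Measure Ω} {n : ℕ}
    {X : Fin n → Ω → ℝ} (hlr : ∀ i j : Fin n, (j : ℕ) = (i : ℕ) + 1 → LrLE μ (X j) (X i))
    (hn : 2 ≤ n) (k : Fin n) : ∃ f, IsDensity μ (X k) f := by
  by_cases hk : (k : ℕ) + 1 < n
  · obtain ⟨f, g, -, hg, -⟩ := hlr k ⟨k + 1, hk⟩ rfl
    exact ⟨g, hg⟩
  · obtain ⟨f, g, hf, -, -⟩ := hlr ⟨k - 1, by omega⟩ k (by simp only; omega)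
    exact ⟨f, hf⟩

lemma incArr_comp_perm {n : ℕ} (x : Fin n → ℝ) (σ : Equiv.Perm (Fin n)) :
    incArr (x ∘ σ) = incArr x :=
  Tuple.comp_perm_comp_sort_eq_comp_sort

end WeightedSums

theorem corollary4p4 {Ω : Type*} [MeasurableSpace Ω] (μ : Measure Ω) [IsProbabilityMeasure μ]
    (p q : ℝ) (hp : p < 0) (hq0 : 0 < q) (hq1 : q < 1) (hpq : p⁻¹ + q⁻¹ = 1)
    (n : ℕ) (X : Fin n → Ω → ℝ)
    (hXmeas : ∀ i, Measurable (X i))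
    (hXnonneg : ∀ i, ∀ᵐ ω ∂μ, 0 ≤ X i ω)
    (hXindep : iIndepFun X μ)
    (hXlr : ∀ i j : Fin n, (j : ℕ) = (i : ℕ) + 1 → WeightedSums.LrLE μ (X j) (X i))
    (hXlc : ∀ i, WeightedSums.HasLogConcaveDensity μ (fun ω => X i ω ^ p))
    (a b : Fin n → ℝ) (ha : ∀ i, 0 ≤ a i) (hb : ∀ i, 0 ≤ b i)
    (hab : WeightedSums.WeakSubmajorizedBy (fun i => b i ^ q) (fun i => a i ^ q)) :
    WeightedSums.StLE μ
      (fun ω => ∑ i : Fin n, WeightedSums.incArr b (Fin.rev i) * X i ω)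
      (fun ω => ∑ i : Fin n, WeightedSums.incArr a (Fin.rev i) * X i ω) := by
  intro τ
  set G : (Fin n → ℝ) → ℝ≥0∞ := fun c => μ {ω | ∑ k, c k * X k ω ≤ τ} with hG
  have hswap : ∀ (c : Fin n → ℝ) (i j : Fin n), (j : ℕ) = i + 1 → c j ≤ c i →
      G c ≤ G (c ∘ Equiv.swap i j) := fun c i j hij hc =>
    WeightedSums.measure_sum_le_swap hXmeas hXindep
      (WeightedSums.exists_isDensity_of_lrLE hXlr (by omega)) (fun h => by simp [h] at hij)
      (hXlr i j hij) hc τ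
  set x : Fin n → ℝ := fun k => WeightedSums.incArr b (Fin.rev k) ^ q with hx
  have hxb : x = (fun i => b i ^ q) ∘ (Fin.revPerm.trans (Tuple.sort b)) := rfl
  have hxa : WeightedSums.WeakSubmajorizedBy x (fun i => a i ^ q) := fun j => by
    rw [hxb, WeightedSums.incArr_comp_perm]
    exact hab j
  have hx0 : 0 ≤ x := fun k => Real.rpow_nonneg (hb _) q
  obtain ⟨v, hv, hxv⟩ := hxa.exists_mem_convexHull
  -- The level is the value of `G` at the decreasing arrangement of `a`, its minimum over
  -- rearrangements.
  have hcvx := WeightedSums.convex_setOf_le_measure_sum_le (r := q⁻¹) hp (by linarith) hXmeas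
    hXnonneg hXindep hXlc τ (G (WeightedSums.incArr a ∘ Fin.rev))
  obtain ⟨hv0, hGv⟩ := convexHull_min (by
    rintro _ ⟨π, rfl⟩
    refine ⟨fun k => Real.rpow_nonneg (ha _) q, ?_⟩
    have := WeightedSums.le_of_adjacent_swap G hswap (a ∘ π)
    rw [WeightedSums.incArr_comp_perm] at this
    simpa only [hG, Function.comp_apply, Real.rpow_rpow_inv (ha _) hq0.ne'] using this) hcvx hv
  refine hGv.trans (measure_mono_ae ?_)
  filter_upwards [ae_all_iff.2 hXnonneg] with ω hω hle
  refine le_trans (Finset.sum_le_sum fun k _ => mul_le_mul_of_nonneg_right ?_ (hω k)) hle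
  calc WeightedSums.incArr b (Fin.rev k) = x k ^ q⁻¹ := (Real.rpow_rpow_inv (hb _) hq0.ne').symm
    _ ≤ v k ^ q⁻¹ := Real.rpow_le_rpow (hx0 k) (hxv k) (inv_nonneg.2 hq0.le)
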